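/- Let $d\ge 1$, let $G=([d],E)$ be a simple graph on $[d]=\{1,\dots,d\}$, let $\lambda=(\lambda_1,\dots,\lambda_d)\in\mathbb{Z}^d$ and $\Lambda:=\lambda_1+\cdots+\lambda_d$. Let $q$ be a nonzero element of a field $K$ (for instance, $q$ an indeterminate and $K=\mathbb{Q}(q)$), and let $z$ be an indeterminate; all series below are formal Laurent series in $z$ over $K$. For $n\ge 0$ put $$\chi_G^\lambda(q,n):=\sum_{c} q^{\lambda_1c(1)+\cdots+\lambda_dc(d)},$$ where the sum runs over all proper colorings $c:[d]\to\{1,\dots,n\}$ of $G$. Put $$\widehat{K_G}:=\{x\in\mathbb{R}^{d+1} : 0<x_1,\dots,x_d<x_{d+1},\ x_i\ne x_j \text{ for } ij\in E\},$$ and for $S\subseteq\mathbb{R}^{d+1}$ let $\sigma_S(z_1,\dots,z_{d+1}):=\sum_{m\in S\cap\mathbb{Z}^{d+1}} z_1^{m_1}\cdots z_{d+1}^{m_{d+1}}$ be its integer point transform. For a permutation $\pi\in S_d$ and $i\in[d]$, the rank $\mathrm{rk}(\pi(i))$ is the largest $r\geq 1$ for which there are positions $i_1<\cdots<i_r=i$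 with $\{\pi(i_j),\pi(i_{j+1})\}\in E$ for $1\le j<r$. Let $\mathrm{asc}_G(\pi)$ be the set of all $j\in[d-1]$ such that either $\mathrm{rk}(\pi(j))<\mathrm{rk}(\pi(j+1))$, or $\mathrm{rk}(\pi(j))=\mathrm{rk}(\pi(j+1))$ and $\pi(j)<\pi(j+1)$. Then the formal sum $\sigma_{\widehat{K_G}}(q^{\lambda_1},\dots,q^{\lambda_d},z)$ is well defined (the exponents of $z$ are bounded below and each power of $z$ occurs only finitely often), and $$\sum_{n\ge0}\chi_G^\lambda(q,n)z^n = z^{-1}\,\sigma_{\widehat{K_G}}(q^{\lambda_1},\dots,q^{\lambda_d},z) =\sum_{\pi\in S_d}\frac{q^{\Lambda+\sum_{j\in\mathrm{asc}_G(\pi)}(\lambda_{\pi(j+1)}+\cdots+\lambda_{\pi(d)})}\;z^{|\mathrm{asc}_G(\pi)|+1}}{(1-z)\prod_{i=1}^{d}\bigl(1-q^{\lambda_{\pi(i)}+\cdots+\lambda_{\pi(d)}}z\bigr)}.$$ -/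

import Mathlib

/-! Graphs on `[d]` are simple graphs on `Fin d`. The positions and the vertices
`1, …, d` are the elements `0, …, d - 1` of `Fin d`, in the same order, and
`π : Equiv.Perm (Fin d)` is the word `π 0, π 1, …, π (d - 1)`. -/

namespace GStat

variable {d : ℕ}

/-- `HasChain G π v r`: there are positions `p₁ < p₂ < ⋯ < p_r` with `π(p_r) = v` such that
`π(p_j)` and `π(p_{j+1})` are adjacent for `1 ≤ j < r`; here `r = k + 1 ≥ 1`. -/
def HasChain (G : SimpleGraph (Fin d)) (π : Equiv.Perm (Fin d)) (v : Fin d) (r : ℕ) : Prop :=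
  ∃ k : ℕ, r = k + 1 ∧ ∃ p : Fin (k + 1) → Fin d, StrictMono p ∧ π (p (Fin.last k)) = v ∧
    ∀ j : Fin k, G.Adj (π (p j.castSucc)) (π (p j.succ))

/-- The rank of the vertex `v` with respect to `π`: the largest `r` with `HasChain G π v r`
(the maximum exists, see `isGreatest_rank`). -/
noncomputable def rank (G : SimpleGraph (Fin d)) (π : Equiv.Perm (Fin d)) (v : Fin d) : ℕ :=
  sSup {r : ℕ | HasChain G π v r}

theorem isGreatest_rank (G : SimpleGraph (Fin d)) (π : Equiv.Perm (Fin d)) (v : Fin d) :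
    IsGreatest {r : ℕ | HasChain G π v r} (rank G π v) := by
  have hne : {r : ℕ | HasChain G π v r}.Nonempty :=
    ⟨1, 0, rfl, fun _ => π.symm v, fun a b h => by omega, by simp, fun j => j.elim0⟩
  have hb : BddAbove {r : ℕ | HasChain G π v r} := by
    refine ⟨d, ?_⟩
    rintro r ⟨k, rfl, p, hp, -, -⟩
    simpa using Fintype.card_le_of_injective p hp.injective
  exact ⟨Nat.sSup_mem hne hb, fun r hr => le_csSup hb hr⟩

open Classical in
/-- The set of `G`-ascents of `π`: the positions `j`, other than the last one, such that
`rk(π(j)) < rk(π(j+1))`, or `rk(π(j)) = rk(π(j+1))` and `π(j) < π(j+1)`. -/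
noncomputable def asc (G : SimpleGraph (Fin d)) (π : Equiv.Perm (Fin d)) : Finset (Fin d) :=
  Finset.univ.filter fun j => ∃ h : (j : ℕ) + 1 < d,
    rank G π (π j) < rank G π (π ⟨j + 1, h⟩) ∨
      (rank G π (π j) = rank G π (π ⟨j + 1, h⟩) ∧ π j < π ⟨j + 1, h⟩)

open Classical in
/-- The `q`-chromatic polynomial `χ_G^lam(q, n) = ∑_c q ^ (∑_v lam_v c(v))`, the sum being over
the proper colorings `c` of `G` with colors `1, …, n`. Mathlib's colorings by `Fin n` use the
colors `0, …, n - 1`, whence the `+ 1`. -/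
noncomputable def qChromatic {K : Type*} [Field K] (G : SimpleGraph (Fin d)) (lam : Fin d → ℤ)
    (q : K) (n : ℕ) : K :=
  ∑ c : G.Coloring (Fin n), q ^ (∑ v, lam v * (((c v : ℕ) : ℤ) + 1))

/-- The homogenized region of proper colorings: the set of `x ∈ ℝ^{d+1}` such that
`0 < x₁, …, x_d < x_{d+1}` and `x_i ≠ x_j` for all edges `ij`. -/
def KHat (G : SimpleGraph (Fin d)) : Set (Fin (d + 1) → ℝ) :=
  {x | (∀ i : Fin d, 0 < x i.castSucc ∧ x i.castSucc < x (Fin.last d)) ∧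
    ∀ i j : Fin d, G.Adj i j → x i.castSucc ≠ x j.castSucc}

section IntegerPointTransform

variable {n : ℕ} {K : Type*} [Field K]

/-- The set of lattice points of `S ⊆ ℝⁿ`. -/
def latticePoints (S : Set (Fin n → ℝ)) : Set (Fin n → ℤ) :=
  {m | (fun i => (m i : ℝ)) ∈ S}

/-- The family of monomials `w^m = w₁^{m₁} ⋯ w_n^{m_n}`, where `m` runs over the lattice points
of `S` and `w₁, …, w_n` are formal Laurent series. -/
noncomputable def monomials (S : Set (Fin n → ℝ)) (w : Fin n → LaurentSeries K) :
    latticePoints S → LaurentSeries K :=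
  fun m => ∏ i, w i ^ (m : Fin n → ℤ) i

/-- The infinite sum `∑ w^m` over the lattice points `m` of `S` makes sense as a formal Laurent
series: the supports of the monomials have a well-ordered union, and only finitely many
monomials contribute to any given coefficient. -/
def IsTransformSummable (S : Set (Fin n → ℝ)) (w : Fin n → LaurentSeries K) : Prop :=
  ∃ s : HahnSeries.SummableFamily ℤ K (latticePoints S), ⇑s = monomials S w

open Classical in
/-- The integer point transform `σ_S(w₁, …, w_n) = ∑_{m ∈ S ∩ ℤⁿ} w^m`, evaluated at formal
Laurent series: the formal (coefficientwise) sum, with the value `0` if that sum does not make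
sense. -/
noncomputable def integerPointTransform (S : Set (Fin n → ℝ)) (w : Fin n → LaurentSeries K) :
    LaurentSeries K :=
  if h : IsTransformSummable S w then h.choose.hsum else 0

/-- The value does not depend on the choice made in the definition. -/
theorem integerPointTransform_eq_hsum (S : Set (Fin n → ℝ)) (w : Fin n → LaurentSeries K)
    (s : HahnSeries.SummableFamily ℤ K (latticePoints S)) (hs : ⇑s = monomials S w) :
    integerPointTransform S w = s.hsum := by
  have h : IsTransformSummable S w := ⟨s, hs⟩
  have e : h.choose = s := DFunLike.coe_injective (h.choose_spec.trans hs.symm)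
  rw [integerPointTransform, dif_pos h, e]

end IntegerPointTransform

/-- The variable `z` of the ring of formal Laurent series. -/
noncomputable def zVar (K : Type*) [Field K] : LaurentSeries K := HahnSeries.single 1 1

/-- The arguments `(q^{lam₁}, …, q^{lam_d}, z)` of the integer point transform. -/
noncomputable def specialization {K : Type*} [Field K] (lam : Fin d → ℤ) (q : K) :
    Fin (d + 1) → LaurentSeries K :=
  Fin.snoc (α := fun _ => LaurentSeries K)
    (fun i => (HahnSeries.C (q ^ lam i) : LaurentSeries K)) (zVar K)

end GStat

/-! A proper labelling `c` of the vertices orients every edge towards the larger label. Sort the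
vertices by increasing label, breaking ties by decreasing rank in this orientation and further ties
by decreasing vertex. The resulting permutation `π` induces the same orientation, since adjacent
vertices have different labels, so its ranks are those of `c`, and along `π` the labels increase
weakly, and strictly at the `G`-ascents. Conversely, if the labels increase in this way along `π`,
then adjacent vertices have different labels: between equal labels there is no `G`-ascent, hence
the rank weakly decreases, whereas it goes up along an edge. Thus `c` is proper, and `π` is
recovered from `c` by sorting. So each proper labelling is compatible with exactly one permutation
(`existsUnique_compatible`), and `qChromatic` splits as a sum over permutations
(`qChromatic_eq_sum`).

For a fixed permutation, a sequence that increases weakly, and strictly at prescribed places, is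
determined by arbitrary natural numbers, its increments less the forced ones. Summation by parts
turns its weight into a monomial in these increments, and together with the gap between the last
term and the bound they give `d + 1` geometric series (`mk_sum_isStepMono`).

The lattice points of the homogenized region with last coordinate `n + 1` are the proper colorings
with `n` colors, which identifies the integer point transform (`integerPointTransform_KHat`). -/

namespace GStat
variable {d : ℕ}

/-! ### Sorting a proper coloring -/

/-- `π` is compatible with the vertex labelling `c`: read along `π`, the labels increase weakly,
and strictly at the `G`-ascents of `π`. -/
def Compatible {α : Type*} [LinearOrder α] (G : SimpleGraph (Fin d)) (π : Equiv.Perm (Fin d))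
    (c : Fin d → α) : Prop :=
  ∀ (j : Fin d) (h : (j : ℕ) + 1 < d), c (π j) ≤ c (π ⟨j + 1, h⟩) ∧
    (j ∈ asc G π → c (π j) < c (π ⟨j + 1, h⟩))

/-- The rank of the vertex `v` in the orientation of `G` along which `c` increases: the largest
number of vertices on a path ending at `v` with consecutive vertices adjacent and `c` strictly
increasing. -/
noncomputable def labelRank {α : Type*} [LinearOrder α] (G : SimpleGraph (Fin d))
    (c : Fin d → α) (v : Fin d) : ℕ :=
  sSup {r : ℕ | ∃ k : ℕ, r = k + 1 ∧ ∃ p : Fin (k + 1) → Fin d, p (Fin.last k) = v ∧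
    ∀ j : Fin k, G.Adj (p j.castSucc) (p j.succ) ∧ c (p j.castSucc) < c (p j.succ)}

/-- The rank with respect to `π` only depends on the acyclic orientation that `π` induces. -/
theorem rank_eq_labelRank_symm (G : SimpleGraph (Fin d)) (π : Equiv.Perm (Fin d)) :
    rank G π = labelRank G π.symm := by
  funext v
  unfold rank labelRank
  congr 1
  ext r
  constructor
  · rintro ⟨k, rfl, p, hp, hv, hadj⟩
    exact ⟨k, rfl, π ∘ p, hv, fun j => ⟨hadj j, by simpa using hp j.castSucc_lt_succ⟩⟩
  · rintro ⟨k, rfl, p, hv, h⟩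
    exact ⟨k, rfl, π.symm ∘ p, Fin.strictMono_iff_lt_succ.2 fun j => (h j).2, by simp [hv],
      fun j => by simpa using (h j).1⟩

theorem labelRank_congr {α β : Type*} [LinearOrder α] [LinearOrder β] {G : SimpleGraph (Fin d)}
    {c : Fin d → α} {c' : Fin d → β} (h : ∀ u v, G.Adj u v → (c u < c v ↔ c' u < c' v)) :
    labelRank G c = labelRank G c' := by
  funext v
  unfold labelRank
  congr 1
  ext r
  have edge (u v : Fin d) : (G.Adj u v ∧ c u < c v) ↔ (G.Adj u v ∧ c' u < c' v) :=
    and_congr_right (h u v)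
  simp only [edge, Set.mem_ofPred_eq]

theorem rank_lt_rank {G : SimpleGraph (Fin d)} {π : Equiv.Perm (Fin d)} {u v : Fin d}
    (hadj : G.Adj u v) (hlt : π.symm u < π.symm v) : rank G π u < rank G π v := by
  obtain ⟨k, hk, p, hp, hu, hp'⟩ := (isGreatest_rank G π u).1
  refine lt_of_lt_of_le (Nat.lt_succ_self _) ((isGreatest_rank G π v).2 ?_)
  have hu' : p (Fin.last k) = π.symm u := by simp [← hu]
  refine ⟨k + 1, by rw [hk], Fin.snoc (α := fun _ => Fin d) p (π.symm v), ?_, by simp, ?_⟩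
  · rw [Fin.strictMono_iff_lt_succ]
    intro j
    induction j using Fin.lastCases with
    | last => simpa [hu'] using hlt
    | cast j =>
      rw [← Fin.castSucc_succ]
      simpa only [Fin.snoc_castSucc] using hp j.castSucc_lt_succ
  · intro j
    induction j using Fin.lastCases with
    | last => simpa [hu'] using hadj
    | cast j =>
      rw [← Fin.castSucc_succ]
      simpa only [Fin.snoc_castSucc] using hp' j

/-- The key by which a labelling `c` is sorted: by label, ties broken by decreasing `r`, further
ties by decreasing vertex. -/
def sortKey {α : Type*} (c : Fin d → α) (r : Fin d → ℕ) (v : Fin d) :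
    α ×ₗ (ℕ ×ₗ Fin d)ᵒᵈ :=
  toLex (c v, OrderDual.toDual (toLex (r v, v)))

theorem sortKey_injective {α : Type*} (c : Fin d → α) (r : Fin d → ℕ) :
    Function.Injective (sortKey c r) := fun u v h => by
  have := congrArg (fun x => (ofLex (OrderDual.ofDual (ofLex x).2)).2) h
  simpa [sortKey] using this

theorem sortKey_lt_iff {α : Type*} [LinearOrder α] {c : Fin d → α} {r : Fin d → ℕ} {u v : Fin d} :
    sortKey c r u < sortKey c r v ↔
      c u < c v ∨ (c u = c v ∧ (r v < r u ∨ (r v = r u ∧ v < u))) := by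
  simp [sortKey, Prod.Lex.toLex_lt_toLex]

theorem strictMono_iff_lt_next {β : Type*} [Preorder β] {f : Fin d → β} :
    StrictMono f ↔ ∀ (j : Fin d) (h : (j : ℕ) + 1 < d), f j < f ⟨j + 1, h⟩ := by
  cases d with
  | zero => exact ⟨fun _ j => j.elim0, fun _ j => j.elim0⟩
  | succ e =>
    rw [Fin.strictMono_iff_lt_succ]
    exact ⟨fun H j h => H ⟨j, by omega⟩, fun H j => H j.castSucc (by simp)⟩

theorem compatible_iff_strictMono_sortKey {α : Type*} [LinearOrder α] {G : SimpleGraph (Fin d)}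
    {π : Equiv.Perm (Fin d)} {c : Fin d → α} :
    Compatible G π c ↔ StrictMono (sortKey c (rank G π) ∘ π) := by
  rw [strictMono_iff_lt_next]
  refine forall₂_congr fun j h => ?_
  have hne : π j ≠ π ⟨j + 1, h⟩ := fun e => by
    have := congrArg Fin.val (π.injective e)
    simp at this
  have hasc : j ∈ asc G π ↔ rank G π (π j) < rank G π (π ⟨j + 1, h⟩) ∨
      (rank G π (π j) = rank G π (π ⟨j + 1, h⟩) ∧ π j < π ⟨j + 1, h⟩) := by
    simp [asc, h]
  rw [hasc, Function.comp_apply, Function.comp_apply, sortKey_lt_iff]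
  rcases lt_trichotomy (c (π j)) (c (π ⟨j + 1, h⟩)) with hc | hc | hc
  · simp [hc, hc.le]
  · rcases lt_trichotomy (rank G π (π j)) (rank G π (π ⟨j + 1, h⟩)) with hr | hr | hr
    · simp [hc, hr, hr.not_gt, hr.ne']
    · simpa [hc, hr] using ⟨fun h => lt_of_le_of_ne h hne.symm, le_of_lt⟩
    · simp [hc, hr, hr.not_gt, hr.ne']
  · simp [hc.not_ge, hc.not_gt, hc.ne']

/-- A proper labelling and a compatible permutation orient the edges of `G` in the same way, so
that they define the same ranks; hence compatibility means that `π` sorts the labelling by a key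
that does not involve `π`. -/
theorem compatible_iff_proper_and_strictMono {α : Type*} [LinearOrder α]
    {G : SimpleGraph (Fin d)} {π : Equiv.Perm (Fin d)} {c : Fin d → α} :
    Compatible G π c ↔ (∀ u v, G.Adj u v → c u ≠ c v) ∧
      StrictMono (sortKey c (labelRank G c) ∘ π) := by
  -- Agreement in one direction suffices, since the positions and the labels are linearly ordered.
  have agree (hlt : ∀ u v, G.Adj u v → π.symm u < π.symm v → c u < c v) :
      rank G π = labelRank G c := by
    rw [rank_eq_labelRank_symm]
    refine labelRank_congr fun u v huv => ⟨hlt u v huv, fun h => ?_⟩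
    by_contra hn
    have hne : π.symm v ≠ π.symm u := fun e => huv.ne (π.symm.injective e).symm
    exact (hlt v u huv.symm (lt_of_le_of_ne (not_lt.1 hn) hne)).not_gt h
  rw [compatible_iff_strictMono_sortKey]
  constructor
  · intro H
    have hlt (u v) (huv : G.Adj u v) (h : π.symm u < π.symm v) : c u < c v := by
      have h1 := H h
      have h2 := rank_lt_rank huv h
      simp only [Function.comp_apply, Equiv.apply_symm_apply, sortKey_lt_iff] at h1
      rcases h1 with h1 | ⟨-, h1 | h1⟩
      · exact h1
      · exact absurd h1 h2.not_gt
      · exact absurd h1.1 h2.ne'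
    refine ⟨fun u v huv => ?_, agree hlt ▸ H⟩
    have hne : π.symm u ≠ π.symm v := fun e => huv.ne (π.symm.injective e)
    rcases lt_or_gt_of_ne hne with h | h
    · exact (hlt u v huv h).ne
    · exact (hlt v u huv.symm h).ne'
  · rintro ⟨hproper, H⟩
    rw [agree ?_]
    · exact H
    intro u v huv h
    have h1 := H h
    simp only [Function.comp_apply, Equiv.apply_symm_apply, sortKey_lt_iff] at h1
    exact h1.resolve_right fun h2 => hproper u v huv h2.1

/-- Every proper labelling is compatible with exactly one permutation. -/
theorem existsUnique_compatible {α : Type*} [LinearOrder α] {G : SimpleGraph (Fin d)}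
    {c : Fin d → α} (hc : ∀ u v, G.Adj u v → c u ≠ c v) :
    ∃! π : Equiv.Perm (Fin d), Compatible G π c := by
  simp only [compatible_iff_proper_and_strictMono]
  have hinj := sortKey_injective c (labelRank G c)
  refine ⟨Tuple.sort (sortKey c (labelRank G c)), ⟨hc,
    (Tuple.monotone_sort _).strictMono_of_injective (hinj.comp (Equiv.injective _))⟩, fun π hπ => Equiv.ext fun i => hinj ?_⟩
  exact congrFun (Tuple.unique_monotone hπ.2.monotone (Tuple.monotone_sort _)) i

/-! ### Weakly increasing sequences with prescribed strict steps -/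

/-- The sequence `a` increases weakly, and strictly from each position in `S` to the next. -/
def IsStepMono {α : Type*} [LinearOrder α] (S : Finset (Fin d)) (a : Fin d → α) : Prop :=
  ∀ (j : Fin d) (h : (j : ℕ) + 1 < d), a j ≤ a ⟨j + 1, h⟩ ∧ (j ∈ S → a j < a ⟨j + 1, h⟩)

/-- The sequence whose increments are those in `b`, each one increased by one if the preceding
position lies in `S`. -/
def stepSeq (S : Finset (Fin d)) (b : Fin d → ℕ) (i : Fin d) : ℕ :=
  ∑ j ∈ Finset.Iic i, b j + {j ∈ S | j < i}.card

theorem stepSeq_zero {e : ℕ} (S : Finset (Fin (e + 1))) (b : Fin (e + 1) → ℕ) :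
    stepSeq S b 0 = b 0 := by
  have h : Finset.Iic (0 : Fin (e + 1)) = {0} := by ext; simp
  simp [stepSeq, h]

theorem stepSeq_succ {e : ℕ} (S : Finset (Fin (e + 1))) (b : Fin (e + 1) → ℕ) (j : Fin e) :
    stepSeq S b j.succ =
      stepSeq S b j.castSucc + b j.succ + if j.castSucc ∈ S then 1 else 0 := by
  have h1 : Finset.Iic j.succ = insert j.succ (Finset.Iic j.castSucc) := by
    ext i
    simp only [Finset.mem_Iic, Finset.mem_insert, Fin.le_iff_val_le_val, Fin.ext_iff, Fin.val_succ,
      Fin.val_castSucc]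
    omega
  have h2 : {i ∈ S | i < j.succ} =
      {i ∈ S | i < j.castSucc} ∪ if j.castSucc ∈ S then {j.castSucc} else ∅ := by
    ext i
    by_cases hj : j.castSucc ∈ S
    · simp only [hj, if_true, Finset.mem_union, Finset.mem_filter, Finset.mem_singleton,
        Fin.lt_def, Fin.val_succ, Fin.val_castSucc]
      constructor
      · rintro ⟨hi, hlt⟩
        by_cases h : i = j.castSucc
        · exact Or.inr h
        · refine Or.inl ⟨hi, ?_⟩
          have : (i : ℕ) ≠ j := fun e => h (Fin.ext e)
          omega
      · rintro (⟨hi, hlt⟩ | rfl)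
        · exact ⟨hi, by omega⟩
        · exact ⟨hj, by simp⟩
    · simp only [hj, if_false, Finset.union_empty, Finset.mem_filter, and_congr_right_iff,
        Fin.lt_def, Fin.val_succ, Fin.val_castSucc]
      intro hi
      have : (i : ℕ) ≠ j := fun e => hj (by rwa [← show i = j.castSucc from Fin.ext e])
      omega
  have h3 : ({i ∈ S | i < j.succ}).card =
      ({i ∈ S | i < j.castSucc}).card + if j.castSucc ∈ S then 1 else 0 := by
    rw [h2, Finset.card_union_of_disjoint]
    · split_ifs <;> simp
    · split_ifs <;> simp
  rw [stepSeq, h1, Finset.sum_insert (by simp), h3, stepSeq]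
  ring

theorem stepSeq_injective (S : Finset (Fin d)) : Function.Injective (stepSeq S) := by
  intro b b' h
  cases d with
  | zero => exact Subsingleton.elim _ _
  | succ e =>
    funext i
    induction i using Fin.cases with
    | zero => simpa only [stepSeq_zero] using congrFun h 0
    | succ j =>
      have h1 := congrFun h j.succ
      have h2 := congrFun h j.castSucc
      simp only [stepSeq_succ] at h1
      omega

theorem isStepMono_stepSeq (S : Finset (Fin d)) (b : Fin d → ℕ) : IsStepMono S (stepSeq S b) := by
  intro j h
  cases d with
  | zero => exact j.elim0
  | succ e =>
    have h1 := stepSeq_succ S b ⟨j, by omega⟩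
    simp only [Fin.castSucc_mk, Fin.succ_mk, Fin.eta] at h1
    rw [h1]
    refine ⟨by omega, fun hj => ?_⟩
    rw [if_pos hj]
    omega

theorem exists_stepSeq_eq {S : Finset (Fin d)} {a : Fin d → ℕ} (ha : IsStepMono S a) :
    ∃ b, stepSeq S b = a := by
  cases d with
  | zero => exact ⟨a, Subsingleton.elim _ _⟩
  | succ e =>
    refine ⟨Fin.cons (a 0) fun j : Fin e =>
      a j.succ - a j.castSucc - if j.castSucc ∈ S then 1 else 0, ?_⟩
    funext i
    induction i using Fin.induction with
    | zero => simp [stepSeq_zero]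
    | succ j ih =>
      rw [stepSeq_succ, ih, Fin.cons_succ]
      have h1 : a j.castSucc ≤ a j.succ ∧ (j.castSucc ∈ S → a j.castSucc < a j.succ) :=
        ha j.castSucc (by simp)
      split_ifs with hj
      · have := h1.2 hj
        omega
      · have := h1.1
        omega

theorem stepSeq_le (S : Finset (Fin d)) (b : Fin d → ℕ) (i : Fin d) :
    stepSeq S b i ≤ ∑ j, b j + S.card :=
  add_le_add (Finset.sum_le_sum_of_subset (Finset.subset_univ _))
    (Finset.card_le_card (Finset.filter_subset _ _))

/-- As the last position is not in `S`, the last term of the sequence counts all of `S`. -/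
theorem stepSeq_of_isLast {S : Finset (Fin d)} (hS : ∀ j ∈ S, (j : ℕ) + 1 < d) (b : Fin d → ℕ)
    {i : Fin d} (hi : (i : ℕ) + 1 = d) : stepSeq S b i = ∑ j, b j + S.card := by
  have h1 : Finset.Iic i = Finset.univ := by
    ext j
    simp only [Finset.mem_Iic, Fin.le_def, Finset.mem_univ, iff_true]
    omega
  have h2 : {j ∈ S | j < i} = S := Finset.filter_true_of_mem fun j hj => by
    have := hS j hj
    rw [Fin.lt_def]
    omega
  rw [stepSeq, h1, h2]

/-- Summation by parts for the weight of a step sequence. -/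
theorem sum_mul_stepSeq (S : Finset (Fin d)) (b : Fin d → ℕ) (μ : Fin d → ℤ) :
    ∑ i, μ i * ((stepSeq S b i : ℤ) + 1) =
      (∑ i, μ i + ∑ j ∈ S, ∑ k ∈ Finset.Ioi j, μ k) +
        ∑ j, (b j : ℤ) * ∑ k ∈ Finset.Ici j, μ k := by
  have h1 : ∑ i, μ i * ∑ j ∈ Finset.Iic i, (b j : ℤ) =
      ∑ j, (b j : ℤ) * ∑ k ∈ Finset.Ici j, μ k := by
    simp only [Finset.mul_sum]
    rw [Finset.sum_comm' (t' := Finset.univ) (s' := fun j => Finset.Ici j) (by simp)]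
    exact Finset.sum_congr rfl fun _ _ => Finset.sum_congr rfl fun _ _ => mul_comm _ _
  have h2 : ∑ i, μ i * ({j ∈ S | j < i}.card : ℤ) = ∑ j ∈ S, ∑ k ∈ Finset.Ioi j, μ k := by
    simp only [Finset.card_eq_sum_ones, Nat.cast_sum, Nat.cast_one, Finset.mul_sum, mul_one]
    exact Finset.sum_comm' (by simp [and_comm])
  rw [← h1, ← h2, ← Finset.sum_add_distrib, ← Finset.sum_add_distrib]
  refine Finset.sum_congr rfl fun i _ => ?_
  rw [stepSeq]
  push_cast
  ring

theorem zpow_sum₀ {K ι : Type*} [Field K] {q : K} (hq : q ≠ 0) (s : Finset ι) (f : ι → ℤ) :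
    q ^ (∑ i ∈ s, f i) = ∏ i ∈ s, q ^ f i := by
  classical
  induction s using Finset.induction_on with
  | empty => simp
  | insert a s ha ih => rw [Finset.sum_insert ha, Finset.prod_insert ha, zpow_add₀ hq, ih]

open PowerSeries in
theorem mk_pow_mul_one_sub {K : Type*} [Field K] (u : K) :
    (mk fun n => u ^ n) * (1 - C u * X) = 1 := by
  ext n
  rw [mul_sub, mul_one, ← mul_assoc, map_sub]
  cases n with
  | zero => simp
  | succ n => simp [coeff_succ_mul_X, coeff_mul_C, pow_succ, coeff_one]

open Classical PowerSeries in
/-- The weighted generating function of step sequences by a strict bound on their terms. The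
factor indexed by `none` accounts for the gap between the last term and the bound. -/
theorem mk_sum_isStepMono {K : Type*} [Field K] {q : K} (hq : q ≠ 0) (hd : 1 ≤ d)
    (S : Finset (Fin d)) (hS : ∀ j ∈ S, (j : ℕ) + 1 < d) (μ : Fin d → ℤ) :
    (mk fun n : ℕ => ∑ a : Fin d → Fin n with IsStepMono S a,
        q ^ (∑ i, μ i * (((a i : ℕ) : ℤ) + 1))) =
      C (q ^ (∑ i, μ i + ∑ j ∈ S, ∑ k ∈ Finset.Ioi j, μ k)) * X ^ (S.card + 1) *
        ∏ o : Option (Fin d), mk fun n =>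
          (o.elim 1 fun i => q ^ (∑ k ∈ Finset.Ici i, μ k) : K) ^ n := by
  ext n
  rw [coeff_mk, mul_assoc, coeff_C_mul, coeff_X_pow_mul']
  let last : Fin d := ⟨d - 1, by omega⟩
  have hlast : (last : ℕ) + 1 = d := by simp only [last]; omega
  split_ifs with hn
  swap
  · -- The last term of a step sequence is at least `S.card`, so there is none below a smaller bound.
    rw [mul_zero]
    refine Finset.sum_eq_zero fun a ha => absurd ?_ hn
    have ha' : IsStepMono S fun i => (a i : ℕ) := (Finset.mem_filter.1 ha).2
    obtain ⟨b, hb⟩ := exists_stepSeq_eq ha'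
    have h1 := (congrFun hb last).symm.trans (stepSeq_of_isLast hS b hlast)
    have h2 := (a last).isLt
    omega
  rw [coeff_prod, Finset.mul_sum]
  symm
  have hbound (l : Option (Fin d) →₀ ℕ)
      (hl : l ∈ Finset.finsuppAntidiag Finset.univ (n - (S.card + 1))) (i : Fin d) :
      stepSeq S (fun j => l (some j)) i < n := by
    have h1 := (Finset.mem_finsuppAntidiag.1 hl).1
    rw [Fintype.sum_option] at h1
    have h2 := stepSeq_le S (fun j => l (some j)) i
    omega
  refine Finset.sum_bij (fun l hl i => (⟨_, hbound l hl i⟩ : Fin n)) ?_ ?_ ?_ ?_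
  · intro l hl
    exact Finset.mem_filter.2 ⟨Finset.mem_univ _, isStepMono_stepSeq S _⟩
  · intro l hl l' hl' h
    have h1 : (fun j => l (some j)) = fun j => l' (some j) :=
      stepSeq_injective S (funext fun i => congrArg Fin.val (congrFun h i))
    have h2 := (Finset.mem_finsuppAntidiag.1 hl).1
    have h3 := (Finset.mem_finsuppAntidiag.1 hl').1
    rw [Fintype.sum_option] at h2 h3
    ext o
    cases o with
    | none =>
      have h4 : ∑ j, l (some j) = ∑ j, l' (some j) :=
        Finset.sum_congr rfl fun j _ => congrFun h1 j
      omega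
    | some j => exact congrFun h1 j
  · intro a ha
    have ha' : IsStepMono S fun i => (a i : ℕ) := (Finset.mem_filter.1 ha).2
    obtain ⟨b, hb⟩ := exists_stepSeq_eq ha'
    have h1 := (congrFun hb last).symm.trans (stepSeq_of_isLast hS b hlast)
    have h2 := (a last).isLt
    refine ⟨Finsupp.equivFunOnFinite.symm fun o => o.elim (n - 1 - a last) b, ?_, ?_⟩
    · rw [Finset.mem_finsuppAntidiag, Fintype.sum_option]
      refine ⟨?_, Finset.subset_univ _⟩
      simp only [Finsupp.equivFunOnFinite_symm_apply_apply, Option.elim_none, Option.elim_some]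
      omega
    · funext i
      exact Fin.ext (congrFun hb i)
  · intro l hl
    simp only [coeff_mk]
    rw [Fintype.prod_option]
    simp only [Option.elim_none, one_pow, one_mul, Option.elim_some]
    rw [sum_mul_stepSeq, zpow_add₀ hq _ (∑ j, _)]
    congr 1
    rw [zpow_sum₀ hq]
    exact Finset.prod_congr rfl fun j _ => by rw [← zpow_natCast, ← zpow_mul, mul_comm]

variable {K : Type*} [Field K]

/-! ### The integer point transform of the homogenized region -/

theorem monomials_specialization (S : Set (Fin (d + 1) → ℝ)) (lam : Fin d → ℤ) {q : K}
    (hq : q ≠ 0) (m : latticePoints S) :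
    monomials S (specialization lam q) m =
      HahnSeries.single ((m : Fin (d + 1) → ℤ) (Fin.last d))
        (q ^ ∑ i, lam i * (m : Fin (d + 1) → ℤ) i.castSucc) := by
  rw [monomials, Fin.prod_univ_castSucc]
  simp only [specialization, Fin.snoc_castSucc, Fin.snoc_last, zVar]
  rw [← RatFunc.single_zpow, zpow_sum₀ hq]
  simp only [← map_zpow₀, ← map_prod, zpow_mul]
  rw [HahnSeries.C_apply, HahnSeries.single_mul_single, zero_add, mul_one]

theorem mem_latticePoints_KHat {G : SimpleGraph (Fin d)} {m : Fin (d + 1) → ℤ} :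
    m ∈ latticePoints (KHat G) ↔
      (∀ i : Fin d, 0 < m i.castSucc ∧ m i.castSucc < m (Fin.last d)) ∧
        ∀ i j : Fin d, G.Adj i j → m i.castSucc ≠ m j.castSucc := by
  simp [latticePoints, KHat]

/-- Over a region with at least one coordinate `x_i`, the homogenizing coordinate is bounded below
and bounds the other ones; this makes the sum of monomials summable. -/
theorem isTransformSummable_KHat (hd : 1 ≤ d) (G : SimpleGraph (Fin d)) (lam : Fin d → ℤ) {q : K}
    (hq : q ≠ 0) : IsTransformSummable (KHat G) (specialization lam q) := by
  have hpos (m : latticePoints (KHat G)) : 0 < (m : Fin (d + 1) → ℤ) (Fin.last d) := by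
    have := (mem_latticePoints_KHat.1 m.2).1 ⟨0, by omega⟩
    exact this.1.trans this.2
  refine ⟨⟨monomials (KHat G) (specialization lam q), ?_, fun g => ?_⟩, rfl⟩
  · refine (BddBelow.isWF ⟨0, ?_⟩).isPWO
    rintro x hx
    obtain ⟨m, hm⟩ := Set.mem_iUnion.1 hx
    rw [monomials_specialization _ _ hq] at hm
    rw [HahnSeries.support_single_subset hm]
    exact (hpos m).le
  · refine ((Set.finite_Icc (0 : Fin (d + 1) → ℤ) fun _ => g).preimage
      Subtype.val_injective.injOn).subset fun m hm => ?_
    have hm' : (m : Fin (d + 1) → ℤ) (Fin.last d) = g := by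
      by_contra h
      apply hm
      rw [monomials_specialization _ _ hq, HahnSeries.coeff_single_of_ne (Ne.symm h)]
    have hb := (mem_latticePoints_KHat.1 m.2).1
    refine ⟨fun i => ?_, fun i => ?_⟩
    · induction i using Fin.lastCases with
      | last => exact (hpos m).le
      | cast i => exact (hb i).1.le
    · induction i using Fin.lastCases with
      | last => exact hm'.le
      | cast i => exact hm' ▸ (hb i).2.le

/-- The lattice point of the region with the colors `c v + 1` as its first coordinates and `n + 1`
as its last one. -/
def coloringPoint (G : SimpleGraph (Fin d)) {n : ℕ} (c : G.Coloring (Fin n)) :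
    latticePoints (KHat G) :=
  ⟨Fin.snoc (α := fun _ => ℤ) (fun v => ((c v : ℕ) : ℤ) + 1) ((n : ℤ) + 1), by
    rw [mem_latticePoints_KHat]
    simp only [Fin.snoc_castSucc, Fin.snoc_last]
    refine ⟨fun i => ⟨by omega, by have := (c i).isLt; omega⟩, fun i j hij h => ?_⟩
    exact c.valid hij (Fin.ext (by omega))⟩

theorem coloringPoint_injective (G : SimpleGraph (Fin d)) (n : ℕ) :
    Function.Injective (coloringPoint G (n := n)) := by
  intro c c' h
  apply RelHom.ext
  intro v
  have h1 := congrFun (congrArg Subtype.val h) v.castSucc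
  simp only [coloringPoint, Fin.snoc_castSucc] at h1
  exact Fin.ext (by omega)

theorem mem_range_coloringPoint {G : SimpleGraph (Fin d)} {n : ℕ} {m : latticePoints (KHat G)}
    (hm : (m : Fin (d + 1) → ℤ) (Fin.last d) = n + 1) :
    m ∈ Set.range (coloringPoint G (n := n)) := by
  obtain ⟨m, hmem⟩ := m
  obtain ⟨hb, hadj⟩ := mem_latticePoints_KHat.1 hmem
  simp only at hm
  refine ⟨SimpleGraph.Coloring.mk
    (fun v => ⟨(m v.castSucc - 1).toNat, by have := hb v; omega⟩) ?_, ?_⟩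
  · intro u v huv h
    have h1 := hb u
    have h2 := hb v
    have h3 := congrArg Fin.val h
    simp only at h3
    exact hadj u v huv (by omega)
  · apply Subtype.ext
    funext i
    induction i using Fin.lastCases with
    | last => simp [coloringPoint, hm]
    | cast i =>
      have := hb i
      simp only [coloringPoint, Fin.snoc_castSucc, SimpleGraph.Coloring.mk, RelHom.coeFn_mk]
      omega

theorem integerPointTransform_KHat (hd : 1 ≤ d) (G : SimpleGraph (Fin d)) (lam : Fin d → ℤ) {q : K}
    (hq : q ≠ 0) :
    integerPointTransform (KHat G) (specialization lam q) =
      zVar K * ((PowerSeries.mk fun n : ℕ => qChromatic G lam q n : PowerSeries K) :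
        LaurentSeries K) := by
  classical
  obtain ⟨s, hs⟩ := isTransformSummable_KHat hd G lam hq
  rw [integerPointTransform_eq_hsum _ _ s hs]
  ext k
  obtain ⟨n, rfl⟩ : ∃ n, k = n + 1 := ⟨k - 1, by ring⟩
  rw [zVar, HahnSeries.coeff_single_mul_add, one_mul, HahnSeries.SummableFamily.coeff_hsum, hs,
    PowerSeries.coeff_coe]
  simp only [monomials_specialization _ _ hq]
  split_ifs with hn
  · refine finsum_eq_zero_of_forall_eq_zero fun m => HahnSeries.coeff_single_of_ne ?_
    have := (mem_latticePoints_KHat.1 m.2).1 ⟨0, by omega⟩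
    omega
  · lift n to ℕ using not_lt.1 hn
    rw [PowerSeries.coeff_mk, Int.natAbs_natCast, qChromatic, ← finsum_eq_sum_of_fintype,
      ← finsum_mem_univ, finsum_mem_inter_support_eq' _ _ (Set.range (coloringPoint G (n := n))),
      finsum_mem_range (coloringPoint_injective G n)]
    · simp [coloringPoint]
    · intro m hm
      refine iff_of_true (Set.mem_univ _) (mem_range_coloringPoint ?_)
      by_contra h
      exact hm (HahnSeries.coeff_single_of_ne (Ne.symm h))

/-! ### The generating function of the `q`-chromatic polynomial -/

theorem succ_lt_of_mem_asc {G : SimpleGraph (Fin d)} {π : Equiv.Perm (Fin d)} {j : Fin d}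
    (hj : j ∈ asc G π) : (j : ℕ) + 1 < d := by
  classical
  rw [asc, Finset.mem_filter] at hj
  exact hj.2.1

open Classical in
/-- Proper colorings are grouped by the unique permutation compatible with them. -/
theorem qChromatic_eq_sum (G : SimpleGraph (Fin d)) (lam : Fin d → ℤ) (q : K) (n : ℕ) :
    qChromatic G lam q n = ∑ π : Equiv.Perm (Fin d),
      ∑ a : Fin d → Fin n with IsStepMono (asc G π) a,
        q ^ (∑ i, lam (π i) * (((a i : ℕ) : ℤ) + 1)) := by
  have h1 (π : Equiv.Perm (Fin d)) :
      ∑ a : Fin d → Fin n with IsStepMono (asc G π) a,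
        q ^ (∑ i, lam (π i) * (((a i : ℕ) : ℤ) + 1)) =
      ∑ f : Fin d → Fin n, if Compatible G π f then
        q ^ (∑ v, lam v * (((f v : ℕ) : ℤ) + 1)) else 0 := by
    rw [Finset.sum_filter]
    refine Fintype.sum_equiv (Equiv.arrowCongr π (Equiv.refl (Fin n))) _ _ fun a => ?_
    have h2 : Compatible G π (Equiv.arrowCongr π (Equiv.refl (Fin n)) a) ↔
        IsStepMono (asc G π) a := by
      simp [Compatible, IsStepMono]
    have h3 : ∑ v, lam v * (((Equiv.arrowCongr π (Equiv.refl (Fin n)) a v : ℕ) : ℤ) + 1) =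
        ∑ i, lam (π i) * (((a i : ℕ) : ℤ) + 1) := by
      rw [← Equiv.sum_comp π]
      simp
    simp only [h2, h3]
  simp only [h1]
  rw [Finset.sum_comm]
  have h4 (f : Fin d → Fin n) :
      (∑ π : Equiv.Perm (Fin d), if Compatible G π f then
        q ^ (∑ v, lam v * (((f v : ℕ) : ℤ) + 1)) else 0) =
      if ∀ u v, G.Adj u v → f u ≠ f v then
        q ^ (∑ v, lam v * (((f v : ℕ) : ℤ) + 1)) else 0 := by
    split_ifs with hf
    · obtain ⟨π, hπ, huniq⟩ := existsUnique_compatible hf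
      rw [Finset.sum_eq_single π (fun ρ _ hρ => if_neg fun h => hρ (huniq ρ h))
        (fun h => absurd (Finset.mem_univ _) h), if_pos hπ]
    · exact Finset.sum_eq_zero fun π _ =>
        if_neg fun h => hf (compatible_iff_proper_and_strictMono.1 h).1
  simp only [h4]
  rw [← Finset.sum_filter, qChromatic]
  refine Finset.sum_bij (fun c _ v => c v) ?_ ?_ ?_ ?_
  · exact fun c _ => Finset.mem_filter.2 ⟨Finset.mem_univ _, fun u v huv => c.valid huv⟩
  · exact fun c _ c' _ h => RelHom.ext fun v => congrFun h v
  · exact fun f hf => ⟨SimpleGraph.Coloring.mk f fun {u v} => (Finset.mem_filter.1 hf).2 u v,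
      Finset.mem_univ _, rfl⟩
  · exact fun c _ => rfl

open PowerSeries in
theorem mk_qChromatic {q : K} (hq : q ≠ 0) (hd : 1 ≤ d) (G : SimpleGraph (Fin d))
    (lam : Fin d → ℤ) :
    (mk fun n : ℕ => qChromatic G lam q n) = ∑ π : Equiv.Perm (Fin d),
      C (q ^ ((∑ i, lam i) + ∑ j ∈ asc G π, ∑ k ∈ Finset.Ioi j, lam (π k))) *
        X ^ ((asc G π).card + 1) *
        ∏ o : Option (Fin d), mk fun n =>
          (o.elim 1 fun i => q ^ (∑ k ∈ Finset.Ici i, lam (π k)) : K) ^ n := by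
  classical
  have h (π : Equiv.Perm (Fin d)) :=
    mk_sum_isStepMono hq hd (asc G π) (fun j => succ_lt_of_mem_asc) fun i => lam (π i)
  simp only [Equiv.sum_comp _ lam] at h
  simp only [← h]
  ext n
  simp [qChromatic_eq_sum]

open PowerSeries in
/-- The denominator on the right is a unit of the power series ring, with the product of geometric
series on the left as its inverse. -/
theorem coe_mul_prod_geometric (ι : Type*) [Fintype ι] (f : K⟦X⟧) (u : ι → K) :
    ((f * ∏ o : Option ι, mk fun n => (o.elim 1 u : K) ^ n : K⟦X⟧) : LaurentSeries K) =
      (f : LaurentSeries K) /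
        ((1 - zVar K) * ∏ i, (1 - (HahnSeries.C (u i) : LaurentSeries K) * zVar K)) := by
  have hden : ((1 - zVar K) * ∏ i, (1 - (HahnSeries.C (u i) : LaurentSeries K) * zVar K)) =
      ((∏ o : Option ι, (1 - C (o.elim 1 u) * X) : K⟦X⟧) : LaurentSeries K) := by
    rw [map_prod, Fintype.prod_option]
    simp [zVar]
  have hinv : (∏ o : Option ι, mk fun n => (o.elim 1 u : K) ^ n) *
      (∏ o : Option ι, (1 - C (o.elim 1 u) * X) : K⟦X⟧) = 1 := by
    rw [← Finset.prod_mul_distrib]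
    exact Finset.prod_eq_one fun o _ => mk_pow_mul_one_sub _
  have hinv' := congrArg (HahnSeries.ofPowerSeries ℤ K) hinv
  rw [map_mul, map_one] at hinv'
  rw [hden, eq_div_iff (right_ne_zero_of_mul_eq_one hinv'), ← map_mul, mul_assoc, hinv, mul_one]

end GStat

theorem theorem3p5 {K : Type*} [Field K] (q : K) (hq : q ≠ 0) (d : ℕ) (hd : 1 ≤ d)
    (G : SimpleGraph (Fin d)) (lam : Fin d → ℤ) :
    GStat.IsTransformSummable (GStat.KHat G) (GStat.specialization lam q) ∧
    ((PowerSeries.mk fun n : ℕ => GStat.qChromatic G lam q n : PowerSeries K) : LaurentSeries K) =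
      (GStat.zVar K)⁻¹ *
        GStat.integerPointTransform (GStat.KHat G) (GStat.specialization lam q) ∧
    (GStat.zVar K)⁻¹ *
        GStat.integerPointTransform (GStat.KHat G) (GStat.specialization lam q) =
      ∑ π : Equiv.Perm (Fin d),
        ((HahnSeries.C
              (q ^ ((∑ i, lam i) + ∑ j ∈ GStat.asc G π, ∑ k ∈ Finset.Ioi j, lam (π k))) :
              LaurentSeries K) *
            GStat.zVar K ^ ((GStat.asc G π).card + 1)) /
          ((1 - GStat.zVar K) *
            ∏ i : Fin d,
              (1 - (HahnSeries.C (q ^ (∑ k ∈ Finset.Ici i, lam (π k))) : LaurentSeries K) *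
                GStat.zVar K)) := by
  have hz : GStat.zVar K ≠ 0 := HahnSeries.single_ne_zero one_ne_zero
  have h : ((PowerSeries.mk fun n : ℕ => GStat.qChromatic G lam q n : PowerSeries K) :
      LaurentSeries K) = (GStat.zVar K)⁻¹ *
        GStat.integerPointTransform (GStat.KHat G) (GStat.specialization lam q) := by
    rw [GStat.integerPointTransform_KHat hd G lam hq, inv_mul_cancel_left₀ hz]
  refine ⟨GStat.isTransformSummable_KHat hd G lam hq, h, ?_⟩
  rw [← h, GStat.mk_qChromatic hq hd, map_sum]
  refine Finset.sum_congr rfl fun π _ => ?_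
  rw [GStat.coe_mul_prod_geometric (Fin d), map_mul, map_pow, PowerSeries.coe_C, PowerSeries.coe_X,
    ← GStat.zVar]
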